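/- Let $(\mathcal J,\circ)$ be a nonzero Euclidean Jordan algebra: a finite-dimensional real vector space with a commutative bilinear product $\circ$ satisfying $x^2\circ(x\circ y)=x\circ(x^2\circ y)$, with an identity element $e$, that admits an associative inner product $(\cdot,\cdot)$, i.e. $(x\circ y,z)=(y,x\circ z)$. Let $\mathcal K=\{x\circ x:x\in\mathcal J\}$ be its cone of squares (every symmetric cone is of this form). Every $x\in\mathcal J$ has a spectral decomposition $x=\sum_{i}\lambda_i q_i$ with $\lambda_i\in\mathbb R$ and $(q_i)$ a Jordan frame (pairwise orthogonal primitive idempotents with sum $e$). Put $\operatorname{tr}(x)=\sum_i\lambda_i$, $\exp(x)=\sum_i e^{\lambda_i}q_i$, $\ln x=\sum_i\ln(\lambda_i)q_i$ for $x\in\operatorname{int}\mathcal K$, and $\langle x,y\rangle=\operatorname{tr}(x\circ y)$. Let $\Delta_{\mathcal K}=\{x\in\mathcal K:\operatorname{tr}(x)=1\}$, and let $\Phi_{\mathrm{ent}}(x)=\operatorname{tr}(x\circ\ln x)=\sum_i\lambda_i\ln\lambda_i$ be the symmetric cone negative entropy, extended continuously to the boundary of $\mathcal K$ by $0\ln 0=0$.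 Then: 1. For every $w\in\mathcal J$, the point $\exp(w)/\operatorname{tr}(\exp(w))$ lies in $\operatorname{int}\mathcal K$ and is the unique maximizer of $x\mapsto\langle w,x\rangle-\Phi_{\mathrm{ent}}(x)$ over $\Delta_{\mathcal K}$. 2. Let $\eta>0$, and let $(m^t)$ and $(\tilde m^t)$ be arbitrary sequences in $\mathcal J$ (payoff vectors and predictors). For every $t\ge 0$, the OFTRL update with regularizer $\Phi_{\mathrm{ent}}$ has a unique solution, namely the OSCMWU iterate: $$\operatorname*{argmax}_{x\in\Delta_{\mathcal K}}\Big\{\eta\Big\langle\sum_{k=1}^t m^k+\tilde m^{t+1},x\Big\rangle-\Phi_{\mathrm{ent}}(x)\Big\}=\Big\{\frac{\exp(w^{t+1})}{\operatorname{tr}(\exp(w^{t+1}))}\Big\},\qquad w^{t+1}=\eta\Big(\sum_{k=1}^t m^k+\tilde m^{t+1}\Big).$$ 3. With the same data, a sequence $(x^t)_{t\ge0}$ in $\mathcal J$ is a sequence of OFTRL iterates with regularizer $\Phi_{\mathrm{ent}}$ (that is, $x^0\in\operatorname{argmin}_{\Delta_{\mathcal K}}\Phi_{\mathrm{ent}}$,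 and $x^{t+1}$ solves the above maximization problem for every $t\ge0$) if and only if $x^0=e/\operatorname{tr}(e)$ and $x^{t+1}=\exp(w^{t+1})/\operatorname{tr}(\exp(w^{t+1}))$ for every $t\ge0$. -/

import Mathlib

/-- A finite-dimensional real Jordan algebra `J` (commutative, with identity element `1`, product
written `x * y`) is *Euclidean* if it carries an associative inner product, i.e. a symmetric
positive definite bilinear form `B` such that `B (x * y) z = B y (x * z)`. -/
class IsEuclideanJordanAlgebra (J : Type*) [NonAssocCommRing J] [Module ℝ J] : Prop
    extends IsCommJordan J where
  smul_mul : ∀ (c : ℝ) (x y : J), (c • x) * y = c • (x * y)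
  finiteDimensional : FiniteDimensional ℝ J
  exists_inner : ∃ B : LinearMap.BilinForm ℝ J,
    (∀ x y, B x y = B y x) ∧ (∀ x, x ≠ 0 → 0 < B x x) ∧ (∀ x y z, B (x * y) z = B y (x * z))

namespace EJA

section Algebra

variable {J : Type*} [NonAssocCommRing J]

variable (J) in
/-- The cone of squares `K = {x ∘ x : x ∈ J}`. -/
def coneOfSquares : Set J := {z | ∃ x : J, z = x * x}

/-- A nonzero idempotent that is not the sum of two nonzero idempotents. -/
structure IsPrimitiveIdempotent (p : J) : Prop where
  idem : IsIdempotentElem p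
  ne_zero : p ≠ 0
  not_sum : ¬ ∃ a b : J, IsIdempotentElem a ∧ a ≠ 0 ∧ IsIdempotentElem b ∧ b ≠ 0 ∧ p = a + b

/-- A Jordan frame: pairwise orthogonal primitive idempotents which sum to the identity. -/
structure IsJordanFrame {r : ℕ} (q : Fin r → J) : Prop where
  primitive : ∀ i, IsPrimitiveIdempotent (q i)
  orthogonal : ∀ i j, i ≠ j → q i * q j = 0
  sum_eq_one : ∑ i, q i = 1

variable [Module ℝ J]

/-- A spectral decomposition `x = ∑ i, λ i • q i` of `x` along a Jordan frame `q`. -/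
structure SpectralDecomposition (x : J) where
  r : ℕ
  eigenvalue : Fin r → ℝ
  frame : Fin r → J
  isJordanFrame : IsJordanFrame frame
  eq_sum : x = ∑ i, eigenvalue i • frame i

open Classical in
/-- The trace: the sum of the eigenvalues in a spectral decomposition. In a Euclidean Jordan
algebra a decomposition exists, and the eigenvalues do not depend on it. -/
noncomputable def trace (x : J) : ℝ :=
  if h : Nonempty (SpectralDecomposition x) then ∑ i, h.some.eigenvalue i else 0

open Classical in
/-- The Löwner extension of a scalar function: `x = ∑ i, λ i • q i ↦ ∑ i, f (λ i) • q i`. In a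
Euclidean Jordan algebra a decomposition exists, and the value does not depend on it. -/
noncomputable def loewner (f : ℝ → ℝ) (x : J) : J :=
  if h : Nonempty (SpectralDecomposition x) then
    ∑ i, f (h.some.eigenvalue i) • h.some.frame i
  else 0

/-- The exponential of a Euclidean Jordan algebra. -/
noncomputable def exp (x : J) : J := loewner Real.exp x

/-- The logarithm of a Euclidean Jordan algebra, on the interior of the cone of squares.
(A zero eigenvalue is sent to `Real.log 0 = 0`.) -/
noncomputable def log (x : J) : J := loewner Real.log x

/-- The canonical inner product `⟨x, y⟩ = tr (x ∘ y)`. -/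
noncomputable def inner (x y : J) : ℝ := trace (x * y)

variable (J) in
/-- The generalized simplex, the trace-one slice of the cone of squares. -/
def simplex : Set J := {x | x ∈ coneOfSquares J ∧ trace x = 1}

/-- The symmetric cone negative entropy `Φ(x) = tr (x ∘ ln x) = ∑ i, λ i * ln (λ i)`. On the
boundary of the cone this is its continuous extension (`0 * ln 0 = 0`). -/
noncomputable def negEntropy (x : J) : ℝ := trace (x * log x)

/-- The trace-normalized exponential `exp w / tr (exp w)`. -/
noncomputable def normalizedExp (w : J) : J := (trace (exp w))⁻¹ • exp w

/-- The set of maximizers of `f` over `S`. -/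
def argmax (S : Set J) (f : J → ℝ) : Set J := {x | x ∈ S ∧ IsMaxOn f S x}

/-- The set of minimizers of `f` over `S`. -/
def argmin (S : Set J) (f : J → ℝ) : Set J := {x | x ∈ S ∧ IsMinOn f S x}

/-- The objective maximized by optimistic follow-the-regularized-leader to produce `x^{t+1}`, with
regularizer `Φ`, step size `η`, payoff vectors `m` and predictors `m'`. -/
noncomputable def oftrlObjective (Φ : J → ℝ) (η : ℝ) (m m' : ℕ → J) (t : ℕ) (x : J) : ℝ :=
  η * inner (∑ k ∈ Finset.Icc 1 t, m k + m' (t + 1)) x - Φ x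

/-- `x` is a sequence of OFTRL iterates over the generalized simplex. -/
structure IsOFTRL (Φ : J → ℝ) (η : ℝ) (m m' x : ℕ → J) : Prop where
  init : x 0 ∈ argmin (simplex J) Φ
  step : ∀ t, x (t + 1) ∈ argmax (simplex J) (oftrlObjective Φ η m m' t)

/-- The OSCMWU weight `w^{t+1}`. -/
noncomputable def oscmwuWeight (η : ℝ) (m m' : ℕ → J) (t : ℕ) : J :=
  η • (∑ k ∈ Finset.Icc 1 t, m k + m' (t + 1))

/-- The OSCMWU iterate `x^{t+1} = exp (w^{t+1}) / tr (exp (w^{t+1}))`. -/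
noncomputable def oscmwuIterate (η : ℝ) (m m' : ℕ → J) (t : ℕ) : J :=
  normalizedExp (oscmwuWeight η m m' t)

end Algebra

end EJA

/-! The proof compares two Jordan frames by means of scalar inequalities. Let `w = ∑ λ i • p i`, `x
= ∑ μ j • q j`, `A i j = trace (p i * q j)`, `z = log (trace (exp w))` and `a i = λ i - z`. The
matrix `A` is nonnegative with row and column sums one. Hence the objective at `x` equals `z` plus
the `A`-weighted sum of the gaps `μ a - μ log μ - exp a + μ`. Each gap is nonpositive, and zero
exactly when `μ = exp a`. With the same weights, `trace ((x - y) * (x - y))` for `y = normalizedExp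
w` is the sum of the `(μ - exp a) ^ 2`. So the bound `z` is attained exactly at `x = y`
(`exists_gibbs`, `argmax_inner_sub_negEntropy`).

This rests on three facts about the algebra: every element has a spectral decomposition
(`nonempty_spectralDecomposition`), `trace` is linear (`trace_eq_frameTrace`), and `A` is
nonnegative (`IsJordanFrame.trace_mul_nonneg`). The last two come from Peirce theory for an
arbitrary associative inner product `B`. -/

set_option linter.unusedSectionVars false

namespace EJA

open Polynomial

/-! ### Diagonalization of self-adjoint operators. -/

section SpectralTheorem

/-- The norm induced by `B` stays inside the proof; only a bare basis is returned, so no topology is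
imposed on `V`. -/
theorem exists_basis_eigenvectors {V : Type*} [AddCommGroup V] [Module ℝ V]
    [FiniteDimensional ℝ V] (B : LinearMap.BilinForm ℝ V) (hs : ∀ x y, B x y = B y x)
    (hp : ∀ x, x ≠ 0 → 0 < B x x) (T : V →ₗ[ℝ] V) (hT : ∀ x y, B (T x) y = B x (T y)) :
    ∃ (n : ℕ) (μ : Fin n → ℝ) (b : Module.Basis (Fin n) ℝ V), ∀ i, T (b i) = μ i • b i := by
  let core : InnerProductSpace.Core ℝ V :=
    { inner := fun x y => B x y
      conj_inner_symm := fun x y => hs y x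
      re_inner_nonneg := fun x => by
        rcases eq_or_ne x 0 with rfl | h
        · simp
        · exact (hp x h).le
      add_left := fun x y z => by simp
      smul_left := fun x y r => by simp
      definite := fun x h => by
        by_contra hx
        exact (hp x hx).ne' h }
  let _ : NormedAddCommGroup V := core.toNormedAddCommGroup
  let _ : InnerProductSpace ℝ V := InnerProductSpace.ofCore core.toCore
  have hsymm : T.IsSymmetric := hT
  refine ⟨_, hsymm.eigenvalues rfl, (hsymm.eigenvectorBasis rfl).toBasis, fun i => ?_⟩
  rw [OrthonormalBasis.coe_toBasis]
  exact hsymm.apply_eigenvectorBasis rfl i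

end SpectralTheorem

section Algebra

variable {J : Type*} [NonAssocCommRing J] [Module ℝ J] [IsEuclideanJordanAlgebra J]

instance : IsScalarTower ℝ J J := ⟨IsEuclideanJordanAlgebra.smul_mul⟩

instance : SMulCommClass ℝ J J :=
  ⟨fun c x y => by
    rw [smul_eq_mul, smul_eq_mul, mul_comm x (c • y), IsEuclideanJordanAlgebra.smul_mul,
      mul_comm y x]⟩

instance : FiniteDimensional ℝ J := IsEuclideanJordanAlgebra.finiteDimensional

/-! ### Power associativity. -/

theorem linearized_jordan (a b c d : J) :
    a * (b * c * d) - b * c * (a * d) + (b * (c * a * d) - c * a * (b * d)) +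
      (c * (a * b * d) - a * b * (c * d)) = 0 := by
  have h := two_nsmul_lie_lmul_lmul_add_add_eq_zero a b c
  rw [two_nsmul] at h
  have h3 : (2 : ℝ) • (a * (b * c * d) - b * c * (a * d) + (b * (c * a * d) - c * a * (b * d)) +
      (c * (a * b * d) - a * b * (c * d))) = 0 := by
    rw [two_smul]
    exact DFunLike.congr_fun h d
  exact (smul_eq_zero.mp h3).resolve_left two_ne_zero

/-- Multiplication by `b * (c * d)` in terms of multiplications by shorter products. -/
theorem triple_mul_mul (b c d a : J) :
    b * c * d * a = b * c * (d * a) + c * d * (b * a) + b * d * (c * a) - b * (d * (c * a)) -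
      c * (d * (b * a)) := by
  have h := linearized_jordan a b c d
  rw [mul_comm a (b * c * d), mul_comm a d, mul_comm c a, mul_comm (a * c) d,
    mul_comm (a * c) (b * d), mul_comm (a * b) d, mul_comm (a * b) (c * d), mul_comm a b,
    mul_comm a c] at h
  rw [← sub_eq_zero, ← h]
  abel

theorem mul_mul_self_comm (x y : J) : x * (x * x * y) = x * x * (x * y) := by
  have h := IsCommJordan.lmul_comm_rmul_rmul x y
  rw [mul_comm (x * x) y, ← h, mul_comm]

/-- Writing `L` for multiplication, `key` expresses `L (x * (x * z))` through `L x`, `L z`, `L (x *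
z)` and `L (x * x)`, all of which commute with `L x`. -/
theorem commute_mulLeft_mul_mul {x z : J} (hz : ∀ y, z * (x * y) = x * (z * y))
    (hxz : ∀ y, x * z * (x * y) = x * (x * z * y)) (y : J) :
    x * (x * z) * (x * y) = x * (x * (x * z) * y) := by
  have key : ∀ a, x * (x * z) * a = x * z * (x * a) + (x * x) * (z * a) + x * z * (x * a)
      - x * (x * (z * a)) - z * (x * (x * a)) := by
    intro a
    have h := triple_mul_mul x z x a
    rw [mul_comm (x * z) x, mul_comm z x] at h
    rw [h]
    abel
  rw [key, key]
  simp only [mul_sub, mul_add, hz, hxz, mul_mul_self_comm]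

theorem pow_mulLeft_commute (x : J) (n : ℕ) (y : J) :
    ((LinearMap.mulLeft ℝ x) ^ n) 1 * (x * y) = x * (((LinearMap.mulLeft ℝ x) ^ n) 1 * y) := by
  suffices h : (∀ y, ((LinearMap.mulLeft ℝ x) ^ n) 1 * (x * y)
        = x * (((LinearMap.mulLeft ℝ x) ^ n) 1 * y)) ∧
      ∀ y, ((LinearMap.mulLeft ℝ x) ^ (n + 1)) 1 * (x * y)
        = x * (((LinearMap.mulLeft ℝ x) ^ (n + 1)) 1 * y) from h.1 y
  induction n with
  | zero => simp
  | succ n ih =>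
    refine ⟨ih.2, fun y => ?_⟩
    have h := ih.2
    rw [pow_succ', Module.End.mul_apply, pow_succ', Module.End.mul_apply,
      LinearMap.mulLeft_apply, LinearMap.mulLeft_apply]
    rw [pow_succ', Module.End.mul_apply, LinearMap.mulLeft_apply] at h
    exact commute_mulLeft_mul_mul ih.1 h y

theorem aeval_mulLeft_commute (x : J) (f : ℝ[X]) (y : J) :
    (aeval (LinearMap.mulLeft ℝ x) f) 1 * (x * y) =
      x * ((aeval (LinearMap.mulLeft ℝ x) f) 1 * y) := by
  induction f using Polynomial.induction_on' with
  | add p q hp hq => simp only [map_add, LinearMap.add_apply, add_mul, hp, hq, mul_add]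
  | monomial n a =>
    rw [aeval_monomial, Module.End.mul_apply, Module.algebraMap_end_apply, smul_mul_assoc,
      smul_mul_assoc, mul_smul_comm, pow_mulLeft_commute]

/-- The evaluation of polynomials at an element of a Jordan algebra is multiplicative. -/
theorem aeval_mulLeft_mul (x : J) (f g : ℝ[X]) :
    (aeval (LinearMap.mulLeft ℝ x) f) 1 * (aeval (LinearMap.mulLeft ℝ x) g) 1 =
      (aeval (LinearMap.mulLeft ℝ x) (f * g)) 1 := by
  have h : Commute (LinearMap.mulLeft ℝ ((aeval (LinearMap.mulLeft ℝ x) f) (1 : J)))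
      (aeval (LinearMap.mulLeft ℝ x) g) := by
    have hc : Commute (LinearMap.mulLeft ℝ ((aeval (LinearMap.mulLeft ℝ x) f) (1 : J)))
        (LinearMap.mulLeft ℝ x) := LinearMap.ext fun y => aeval_mulLeft_commute x f y
    induction g using Polynomial.induction_on' with
    | add p q hp hq => rw [map_add]; exact hp.add_right hq
    | monomial n a =>
      rw [aeval_monomial]
      exact (Algebra.commute_algebraMap_right a _).mul_right (hc.pow_right n)
  -- At `1`, commutation of `L (f(x))` with `g(L x)` reads `f(x) * g(x) = g(L x) (f(x))`.
  have := LinearMap.congr_fun h.eq 1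
  simp only [Module.End.mul_apply, LinearMap.mulLeft_apply, mul_one] at this
  rw [this, mul_comm f g, map_mul, Module.End.mul_apply]

/-! ### Orthogonal idempotents from Lagrange interpolation. -/

/-- A symmetric positive definite associative bilinear form. -/
structure IsAssociativeInner (B : LinearMap.BilinForm ℝ J) : Prop where
  symm : ∀ x y, B x y = B y x
  pos : ∀ x, x ≠ 0 → 0 < B x x
  assoc : ∀ x y z, B (x * y) z = B y (x * z)

variable (J) in
theorem exists_isAssociativeInner : ∃ B : LinearMap.BilinForm ℝ J, IsAssociativeInner B :=
  let ⟨B, h1, h2, h3⟩ := IsEuclideanJordanAlgebra.exists_inner (J := J)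
  ⟨B, h1, h2, h3⟩

/-- A finite family of pairwise orthogonal nonzero idempotents which sum to the identity. -/
structure IsOrthogonalResolution {ι : Type*} [Fintype ι] (q : ι → J) : Prop where
  idem : ∀ i, q i * q i = q i
  ne_zero : ∀ i, q i ≠ 0
  orthogonal : ∀ i j, i ≠ j → q i * q j = 0
  sum_eq_one : ∑ i, q i = 1

/-- Multiplication by `x` is self-adjoint for `B`, hence diagonalizable, so a polynomial in it
depends only on its values at the eigenvalues. Lagrange basis polynomials evaluated at `x` therefore
give the idempotents. -/
theorem exists_resolution (x : J) : ∃ (ι : Type) (_ : Fintype ι) (c : ι → ℝ) (q : ι → J),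
    IsOrthogonalResolution q ∧ x = ∑ i, c i • q i := by
  classical
  obtain ⟨B, hB⟩ := exists_isAssociativeInner J
  obtain ⟨n, μ, b, hb⟩ := exists_basis_eigenvectors B hB.symm hB.pos (LinearMap.mulLeft ℝ x)
    (fun y z => hB.assoc x y z)
  set T := LinearMap.mulLeft ℝ x with hT
  have hvan : ∀ f g : ℝ[X], (∀ i, f.eval (μ i) = g.eval (μ i)) → aeval T f = aeval T g := by
    intro f g hfg
    refine b.ext fun i => ?_
    have hv : Module.End.HasEigenvector T (μ i) (b i) :=
      Module.End.hasEigenvector_iff.mpr ⟨Module.End.mem_eigenspace_iff.mpr (hb i), b.ne_zero i⟩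
    rw [Module.End.aeval_apply_of_hasEigenvector hv, Module.End.aeval_apply_of_hasEigenvector hv,
      hfg]
  let S : Finset ℝ := Finset.univ.image μ
  have hS : ∀ i, μ i ∈ S := fun i => Finset.mem_image_of_mem _ (Finset.mem_univ i)
  let f : ℝ → ℝ[X] := fun s => Lagrange.basis S id s
  have hf : ∀ s ∈ S, ∀ t ∈ S, (f s).eval t = if s = t then 1 else 0 := by
    intro s hs t ht
    split_ifs with h
    · subst h
      exact Lagrange.eval_basis_self (v := id) (Set.injOn_id _) hs
    · exact Lagrange.eval_basis_of_ne (v := id) h ht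
  let v : ℝ → J := fun s => aeval T (f s) 1
  have hmul : ∀ s ∈ S, ∀ t ∈ S, v s * v t = if s = t then v s else 0 := by
    intro s hs t ht
    have h1 : v s * v t = aeval T (f s * f t) 1 := aeval_mulLeft_mul x _ _
    split_ifs with h
    · subst h
      rw [h1, hvan (f s * f s) (f s) fun i => by
        rw [eval_mul, hf s hs _ (hS i)]; split_ifs <;> simp]
    · rw [h1, hvan (f s * f t) 0 fun i => by
        rw [eval_mul, hf s hs _ (hS i), hf t ht _ (hS i), eval_zero]
        split_ifs with h2 h3 <;> simp
        exact h (h2.trans h3.symm)]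
      simp
  have hsum : ∑ s ∈ S, v s = 1 := by
    have : ∑ s ∈ S, v s = aeval T (∑ s ∈ S, f s) 1 := by simp [v, LinearMap.sum_apply]
    rw [this, hvan _ 1 fun i => by
      rw [eval_finsetSum, Finset.sum_congr rfl fun s hs => hf s hs _ (hS i)]
      simp [hS i]]
    simp
  have hx : x = ∑ s ∈ S, s • v s := by
    have : ∑ s ∈ S, s • v s = aeval T (∑ s ∈ S, s • f s) 1 := by simp [v, LinearMap.sum_apply]
    rw [this, hvan _ X fun i => by
      rw [eval_finsetSum, Finset.sum_congr rfl fun s hs => by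
        rw [eval_smul, hf s hs _ (hS i)]]
      simp [hS i]]
    simp [hT]
  -- Multiplication by `x` can have eigenvalues outside the spectrum of `x`, such as means of two
  -- spectral values; there `v s = 0`.
  let S' := S.filter fun s => v s ≠ 0
  have hS' : ∀ s : S', (s : ℝ) ∈ S ∧ v s ≠ 0 := fun s => Finset.mem_filter.mp s.2
  refine ⟨S', inferInstance, fun s => s, fun s => v s, ⟨?_, ?_, ?_, ?_⟩, ?_⟩
  · intro s
    rw [hmul _ (hS' s).1 _ (hS' s).1, if_pos rfl]
  · exact fun s => (hS' s).2
  · intro s t hst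
    rw [hmul _ (hS' s).1 _ (hS' t).1, if_neg fun h => hst (Subtype.ext h)]
  · rw [Finset.sum_coe_sort S' v, Finset.sum_filter_ne_zero, hsum]
  · rw [Finset.sum_coe_sort S' fun s => s • v s]
    conv_lhs => rw [hx]
    refine (Finset.sum_filter_of_ne (p := fun s => v s ≠ 0) fun s _ h hv => h ?_).symm
    rw [hv, smul_zero]

/-! ### Peirce calculus of an idempotent. -/

variable {B : LinearMap.BilinForm ℝ J} {p q x : J}

/-- This is `L (L - 1) (2 L - 1) = 0` for `L` multiplication by `p`: the Peirce eigenvalues are `0`,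
`1/2` and `1`. -/
theorem idem_mul_mul_mul (hp : p * p = p) (y : J) :
    p * (p * (p * y)) = (3 / 2 : ℝ) • (p * (p * y)) - (1 / 2 : ℝ) • (p * y) := by
  have h := triple_mul_mul p p p y
  rw [hp, hp] at h
  have h2 : (2 : ℝ) • (p * (p * (p * y))) = (3 : ℝ) • (p * (p * y)) - p * y := by
    rw [eq_sub_iff_add_eq, two_smul, show (3 : ℝ) = 1 + 1 + 1 by norm_num, add_smul, add_smul,
      one_smul]
    nth_rewrite 3 [h]
    abel
  have h3 := congrArg (fun z => (1 / 2 : ℝ) • z) h2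
  simp only [smul_sub, smul_smul] at h3
  norm_num at h3
  exact h3

namespace IsAssociativeInner

theorem nonneg (hB : IsAssociativeInner B) (y : J) : 0 ≤ B y y := by
  rcases eq_or_ne y 0 with rfl | h
  · simp
  · exact (hB.pos y h).le

theorem eq_zero (hB : IsAssociativeInner B) {y : J} (h : B y y = 0) : y = 0 := by
  by_contra hy
  exact (hB.pos y hy).ne' h

/-- The quadratic form of multiplication by an idempotent, along its Peirce decomposition. -/
theorem peirce_form (hB : IsAssociativeInner B) (hp : p * p = p) (y : J) :
    B y (p * y) = B ((2 : ℝ) • (p * (p * y)) - p * y) ((2 : ℝ) • (p * (p * y)) - p * y) +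
      8 * B (p * y - p * (p * y)) (p * y - p * (p * y)) := by
  have h1 : B (p * y) (p * y) = B y (p * (p * y)) := hB.assoc _ _ _
  have h2 : B (p * y) (p * (p * y)) = 3 / 2 * B y (p * (p * y)) - 1 / 2 * B y (p * y) := by
    rw [hB.assoc, idem_mul_mul_mul hp]; simp
  have h3 : B (p * (p * y)) (p * (p * y)) =
      3 / 2 * B (p * y) (p * (p * y)) - 1 / 2 * B (p * y) (p * y) := by
    rw [hB.assoc, idem_mul_mul_mul hp]; simp
  have h4 : B (p * (p * y)) (p * y) = B (p * y) (p * (p * y)) := hB.symm _ _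
  -- The first vector is the Peirce one-component of `y`, the second a quarter of the
  -- half-component; thus `8 = 16 / 2`.
  simp only [map_sub, map_smul, LinearMap.sub_apply, LinearMap.smul_apply, smul_eq_mul]
  rw [h4, h3, h2, h1]
  ring

theorem idem_mul_nonneg (hB : IsAssociativeInner B) (hp : p * p = p) (y : J) :
    0 ≤ B y (p * y) := by
  rw [hB.peirce_form hp]
  have h1 := hB.nonneg ((2 : ℝ) • (p * (p * y)) - p * y)
  have h2 := hB.nonneg (p * y - p * (p * y))
  positivity

theorem idem_mul_eq_zero (hB : IsAssociativeInner B) (hp : p * p = p) {y : J}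
    (h : B y (p * y) = 0) : p * y = 0 := by
  rw [hB.peirce_form hp] at h
  have h1 := hB.nonneg ((2 : ℝ) • (p * (p * y)) - p * y)
  have h2 := hB.nonneg (p * y - p * (p * y))
  have e1 := hB.eq_zero (show B ((2 : ℝ) • (p * (p * y)) - p * y) _ = 0 by linarith)
  have e2 := hB.eq_zero (show B (p * y - p * (p * y)) _ = 0 by linarith)
  rw [← sub_eq_zero.mp e2, two_smul] at e1
  simpa using e1

theorem idem_apply (hB : IsAssociativeInner B) (hq : q * q = q) (p : J) :
    B p q = B q (p * q) := by
  rw [hB.symm]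
  nth_rewrite 1 [← hq]
  rw [hB.assoc, mul_comm]

theorem idem_nonneg (hB : IsAssociativeInner B) (hp : p * p = p) (hq : q * q = q) :
    0 ≤ B p q := by
  rw [hB.idem_apply hq]
  exact hB.idem_mul_nonneg hp q

theorem idem_mul_eq_zero_of_apply (hB : IsAssociativeInner B) (hp : p * p = p) (hq : q * q = q)
    (h : B p q = 0) : p * q = 0 :=
  hB.idem_mul_eq_zero hp (by rw [← hB.idem_apply hq, h])

theorem apply_eq_zero_of_mul (hB : IsAssociativeInner B) (hq : q * q = q) (h : p * q = 0) :
    B p q = 0 := by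
  rw [hB.idem_apply hq, h, map_zero]

end IsAssociativeInner

/-! ### Refinement to a Jordan frame. -/

theorem mul_eq_zero_of_idem_add {a b : J} (ha : a * a = a) (hb : b * b = b)
    (h : (a + b) * (a + b) = a + b) : a * b = 0 := by
  have h2 : (2 : ℝ) • (a * b) = 0 := by
    rw [add_mul, mul_add, mul_add, ha, hb, mul_comm b a] at h
    rw [two_smul, ← sub_eq_zero.mpr h]
    abel
  exact (smul_eq_zero.mp h2).resolve_left two_ne_zero

theorem IsOrthogonalResolution.card_le {ι : Type*} [Fintype ι] {e : ι → J}
    (he : IsOrthogonalResolution e) : Fintype.card ι ≤ Module.finrank ℝ J := by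
  obtain ⟨B, hB⟩ := exists_isAssociativeInner J
  refine LinearIndependent.fintype_card_le_finrank
    (LinearMap.BilinForm.linearIndependent_of_iIsOrtho (B := B) (v := e) ?_ ?_)
  · intro i j hij
    exact hB.apply_eq_zero_of_mul (he.idem j) (he.orthogonal i j hij)
  · exact fun i => (hB.pos _ (he.ne_zero i)).ne'

theorem IsOrthogonalResolution.split {ι : Type*} [Fintype ι] [DecidableEq ι] {e : ι → J}
    (he : IsOrthogonalResolution e) (i : ι) {a b : J} (ha : a * a = a) (ha0 : a ≠ 0)
    (hb : b * b = b) (hb0 : b ≠ 0) (hab : e i = a + b) :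
    IsOrthogonalResolution fun o : Option ι => o.elim b (Function.update e i a) := by
  obtain ⟨B, hB⟩ := exists_isAssociativeInner J
  have h0 : a * b = 0 := mul_eq_zero_of_idem_add ha hb (by rw [← hab, he.idem])
  have hj : ∀ j, j ≠ i → a * e j = 0 ∧ b * e j = 0 := by
    intro j hji
    -- `B a (e j)` and `B b (e j)` are nonnegative with sum zero, so both vanish, and then so do the
    -- products.
    have h1 := hB.apply_eq_zero_of_mul (he.idem j) (he.orthogonal i j hji.symm)
    rw [hab, map_add, LinearMap.add_apply] at h1
    have h2 := hB.idem_nonneg ha (he.idem j)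
    have h3 := hB.idem_nonneg hb (he.idem j)
    exact ⟨hB.idem_mul_eq_zero_of_apply ha (he.idem j) (by linarith),
      hB.idem_mul_eq_zero_of_apply hb (he.idem j) (by linarith)⟩
  refine ⟨?_, ?_, ?_, ?_⟩
  · rintro (_ | j)
    · exact hb
    · rcases eq_or_ne j i with rfl | h
      · simpa using ha
      · simpa [h] using he.idem j
  · rintro (_ | j)
    · exact hb0
    · rcases eq_or_ne j i with rfl | h
      · simpa using ha0
      · simpa [h] using he.ne_zero j
  · rintro (_ | j) (_ | k) hjk
    · exact absurd rfl hjk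
    · rcases eq_or_ne k i with rfl | h
      · simpa [mul_comm b a] using h0
      · simpa [h] using (hj k h).2
    · rcases eq_or_ne j i with rfl | h
      · simpa using h0
      · simpa [h, mul_comm _ b] using (hj j h).2
    · have hne : j ≠ k := fun h => hjk (congrArg some h)
      rcases eq_or_ne j i with rfl | h
      · simpa [hne.symm] using (hj k hne.symm).1
      · rcases eq_or_ne k i with rfl | h'
        · simpa [h, mul_comm _ a] using (hj j h).1
        · simpa [h, h'] using he.orthogonal j k hne
  · rw [Fintype.sum_option]
    simp only [Option.elim]
    rw [Finset.sum_update_of_mem (Finset.mem_univ i), ← he.sum_eq_one,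
      ← Finset.add_sum_erase _ _ (Finset.mem_univ i), hab, Finset.sdiff_singleton_eq_erase]
    abel

/-- The size of a resolution is at most the dimension, so splitting non-primitive members
terminates; `d` bounds the number of splittings left. -/
theorem spectralDecomposition_of_card (d : ℕ) : ∀ {ι : Type} [Fintype ι] {c : ι → ℝ} {e : ι → J},
    IsOrthogonalResolution e → x = ∑ i, c i • e i →
    Module.finrank ℝ J ≤ Fintype.card ι + d → Nonempty (SpectralDecomposition x) := by
  classical
  induction d with
  | zero =>
    intro ι _ c e he hx hd
    refine ⟨⟨_, fun i => c ((Fintype.equivFin ι).symm i), fun i => e ((Fintype.equivFin ι).symm i),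
      ⟨fun i => ⟨he.idem _, he.ne_zero _, ?_⟩, fun i j hij => he.orthogonal _ _ (by simpa using hij),
        ?_⟩, ?_⟩⟩
    · rintro ⟨a, b, ha, ha0, hb, hb0, hab⟩
      have := (he.split _ ha ha0 hb hb0 hab).card_le
      rw [Fintype.card_option] at this
      omega
    · rw [← he.sum_eq_one]
      exact Equiv.sum_comp _ e
    · rw [hx]
      exact (Equiv.sum_comp _ fun i => c i • e i).symm
  | succ d ih =>
    intro ι _ c e he hx hd
    by_cases h : ∃ i, ¬ IsPrimitiveIdempotent (e i)
    · obtain ⟨i, hi⟩ := h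
      obtain ⟨a, b, ha, ha0, hb, hb0, hab⟩ := not_not.mp fun h' => hi ⟨he.idem i, he.ne_zero i, h'⟩
      refine ih (c := fun o => o.elim (c i) c) (he.split i ha ha0 hb hb0 hab) ?_
        (by rw [Fintype.card_option]; omega)
      rw [Fintype.sum_option]
      simp only [Option.elim]
      rw [hx, ← Finset.add_sum_erase _ _ (Finset.mem_univ i),
        ← Finset.add_sum_erase _ (fun j => c j • Function.update e i a j)
          (Finset.mem_univ i), hab, Function.update_self, smul_add,
        Finset.sum_congr (g := fun j => c j • Function.update e i a j) rfl fun j hj => by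
          rw [Function.update_of_ne (Finset.ne_of_mem_erase hj)]]
      abel
    · push Not at h
      refine ⟨⟨_, fun i => c ((Fintype.equivFin ι).symm i),
        fun i => e ((Fintype.equivFin ι).symm i), ⟨fun i => h _,
          fun i j hij => he.orthogonal _ _ (by simpa using hij), ?_⟩, ?_⟩⟩
      · rw [← he.sum_eq_one]
        exact Equiv.sum_comp _ e
      · rw [hx]
        exact (Equiv.sum_comp _ fun i => c i • e i).symm

theorem nonempty_spectralDecomposition (x : J) : Nonempty (SpectralDecomposition x) := by
  obtain ⟨ι, _, c, q, hq, hx⟩ := exists_resolution x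
  exact spectralDecomposition_of_card (Module.finrank ℝ J) hq hx (by omega)

/-! ### Primitive idempotents and linearity of the trace. -/

theorem IsPrimitiveIdempotent.mul_self (hp : IsPrimitiveIdempotent p) : p * p = p := hp.idem

theorem IsPrimitiveIdempotent.eq_of_mul_eq (hp : IsPrimitiveIdempotent p) (hq : q * q = q)
    (hq0 : q ≠ 0) (h : p * q = q) : q = p := by
  by_contra hne
  refine hp.not_sum ⟨q, p - q, hq, hq0, ?_, sub_ne_zero.mpr (Ne.symm hne), by abel⟩
  show (p - q) * (p - q) = p - q
  rw [sub_mul, mul_sub, mul_sub, hp.mul_self, mul_comm q p, h, hq]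
  abel

theorem IsJordanFrame.sum_smul_mul_sum_smul {r : ℕ} {e : Fin r → J} (he : IsJordanFrame e)
    (c d : Fin r → ℝ) : (∑ i, c i • e i) * (∑ i, d i • e i) = ∑ i, (c i * d i) • e i := by
  rw [Finset.sum_mul]
  refine Finset.sum_congr rfl fun i _ => ?_
  rw [Finset.mul_sum, Finset.sum_eq_single i, smul_mul_smul_comm, (he.primitive i).mul_self]
  · intro j _ hj
    rw [smul_mul_smul_comm, he.orthogonal i j hj.symm, smul_zero]
  · simp

/-- The Peirce one-space of a primitive idempotent is one-dimensional. -/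
theorem IsPrimitiveIdempotent.exists_smul (hp : IsPrimitiveIdempotent p) (hx : p * x = x) :
    ∃ c : ℝ, x = c • p := by
  obtain ⟨B, hB⟩ := exists_isAssociativeInner J
  obtain ⟨D⟩ := nonempty_spectralDecomposition x
  have hidem : (1 - p) * (1 - p) = 1 - p := by
    rw [sub_mul, mul_sub, mul_sub, hp.mul_self]
    simp
  have hxx : x * x = ∑ i, (D.eigenvalue i) ^ 2 • D.frame i := by
    simp only [sq]
    rw [← D.isJordanFrame.sum_smul_mul_sum_smul, ← D.eq_sum]
  -- This is a sum of terms `λ i ^ 2 * B (q i) (1 - p) ≥ 0`; every `q i` with `λ i ≠ 0` is thus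
  -- orthogonal to `1 - p`, and primitivity of `p` makes it `p`.
  have h0 : B (x * x) (1 - p) = 0 := by
    rw [hB.assoc, mul_sub, mul_one, mul_comm x p, hx, sub_self, map_zero]
  rw [hxx, map_sum, LinearMap.sum_apply, Finset.sum_eq_zero_iff_of_nonneg] at h0
  · have h1 : ∀ i, D.eigenvalue i ≠ 0 → D.frame i = p := by
      intro i hi
      have h2 := h0 i (Finset.mem_univ i)
      rw [map_smul, LinearMap.smul_apply, smul_eq_mul] at h2
      have hpr := D.isJordanFrame.primitive i
      have h3 := hB.idem_mul_eq_zero_of_apply hpr.mul_self hidem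
        ((mul_eq_zero.mp h2).resolve_left (pow_ne_zero 2 hi))
      rw [mul_sub, mul_one, sub_eq_zero] at h3
      exact hp.eq_of_mul_eq hpr.mul_self hpr.ne_zero (by rw [mul_comm, ← h3])
    refine ⟨∑ i, D.eigenvalue i, ?_⟩
    rw [Finset.sum_smul]
    conv_lhs => rw [D.eq_sum]
    refine Finset.sum_congr rfl fun i _ => ?_
    rcases eq_or_ne (D.eigenvalue i) 0 with h | h
    · rw [h, zero_smul, zero_smul]
    · rw [h1 i h]
  · intro i _
    rw [map_smul, LinearMap.smul_apply, smul_eq_mul]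
    exact mul_nonneg (sq_nonneg _)
      (hB.idem_nonneg (D.isJordanFrame.primitive i).mul_self hidem)

/-- The compression of `y` to the Peirce one-space of a primitive idempotent. -/
theorem IsPrimitiveIdempotent.compression (hB : IsAssociativeInner B)
    (hp : IsPrimitiveIdempotent p) (y : J) :
    (2 : ℝ) • (p * (p * y)) - p * y = (B p y / B p p) • p := by
  obtain ⟨c, hc⟩ := hp.exists_smul (x := (2 : ℝ) • (p * (p * y)) - p * y) (by
    rw [mul_sub, mul_smul_comm, idem_mul_mul_mul hp.mul_self, smul_sub, smul_smul, smul_smul]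
    norm_num
    rw [show (3 : ℝ) = 2 + 1 by norm_num, add_smul, one_smul]
    abel)
  have h := congrArg (B p) hc
  have h1 : B p (p * y) = B p y := by rw [← hB.assoc, hp.mul_self]
  have h2 : B p (p * (p * y)) = B p y := by rw [← hB.assoc, hp.mul_self, h1]
  rw [map_sub, map_smul, map_smul, h1, h2, smul_eq_mul, smul_eq_mul] at h
  rw [hc, ← eq_div_of_mul_eq (hB.pos p hp.ne_zero).ne' (show c * B p p = B p y by linarith)]

/-- Pairing each compression with the other idempotent gives `2 * B (p * q) (p * q) - B p q`,
symmetric in `p` and `q`. It equals `B p q ^ 2` divided by `B p p` and also by `B q q`. -/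
theorem IsPrimitiveIdempotent.norm_eq (hB : IsAssociativeInner B) (hp : IsPrimitiveIdempotent p)
    (hq : IsPrimitiveIdempotent q) (h : B p q ≠ 0) : B p p = B q q := by
  have h1 := congrArg (B q) (hp.compression hB q)
  have h2 := congrArg (B p) (hq.compression hB p)
  have hs := hB.symm q p
  have e1 : B q (p * (p * q)) = B (p * q) (p * q) := (hB.assoc p q (p * q)).symm
  have e2 : B p (q * (q * p)) = B (p * q) (p * q) := by
    rw [← hB.assoc, mul_comm q p]
  have e3 : B q (p * q) = B p q := (hB.idem_apply hq.mul_self p).symm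
  have e4 : B p (q * p) = B p q := by rw [← hB.idem_apply hp.mul_self, hs]
  rw [map_sub, map_smul, map_smul, smul_eq_mul, smul_eq_mul, e1, e3, hs] at h1
  rw [map_sub, map_smul, map_smul, smul_eq_mul, smul_eq_mul, e2, e4, hs] at h2
  have hp0 := (hB.pos p hp.ne_zero).ne'
  have hq0 := (hB.pos q hq.ne_zero).ne'
  have h3 := mul_right_cancel₀ h (h1.symm.trans h2)
  rw [div_eq_div_iff hp0 hq0] at h3
  exact (mul_left_cancel₀ h h3).symm

/-- The functional `x ↦ ∑ k, B (e k) x / B (e k) (e k)`. -/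
noncomputable def frameTrace (B : LinearMap.BilinForm ℝ J) {r : ℕ} (e : Fin r → J) :
    J →ₗ[ℝ] ℝ :=
  ∑ k, (B (e k) (e k))⁻¹ • B (e k)

theorem frameTrace_apply (B : LinearMap.BilinForm ℝ J) {r : ℕ} (e : Fin r → J) (x : J) :
    frameTrace B e x = ∑ k, (B (e k) (e k))⁻¹ * B (e k) x := by
  simp [frameTrace, LinearMap.sum_apply]

/-- By `norm_eq`, all nonzero summands share the normalization `B p p`, so the sum collapses to `B 1
p / B p p`. Value one on every primitive idempotent makes `frameTrace` the sum of eigenvalues along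
any frame. -/
theorem frameTrace_primitive (hB : IsAssociativeInner B) {r : ℕ} {e : Fin r → J}
    (he : IsJordanFrame e) (hp : IsPrimitiveIdempotent p) : frameTrace B e p = 1 := by
  rw [frameTrace_apply]
  have h : ∀ k, (B (e k) (e k))⁻¹ * B (e k) p = (B p p)⁻¹ * B (e k) p := by
    intro k
    rcases eq_or_ne (B (e k) p) 0 with h | h
    · rw [h, mul_zero, mul_zero]
    · rw [(he.primitive k).norm_eq hB hp h]
  rw [Finset.sum_congr rfl fun k _ => h k, ← Finset.mul_sum, ← LinearMap.sum_apply, ← map_sum,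
    he.sum_eq_one]
  have h1 : B 1 p = B p p := by rw [hB.idem_apply hp.mul_self, one_mul]
  rw [h1, inv_mul_cancel₀ (hB.pos p hp.ne_zero).ne']

theorem trace_eq_frameTrace (hB : IsAssociativeInner B) {r : ℕ} {e : Fin r → J}
    (he : IsJordanFrame e) (x : J) : trace x = frameTrace B e x := by
  have h := nonempty_spectralDecomposition x
  rw [trace, dif_pos h]
  conv_rhs => rw [h.some.eq_sum]
  rw [map_sum]
  refine Finset.sum_congr rfl fun i _ => ?_
  rw [map_smul, frameTrace_primitive hB he (h.some.isJordanFrame.primitive i), smul_eq_mul, mul_one]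

variable (J) in
theorem exists_isJordanFrame : ∃ (r : ℕ) (e : Fin r → J), IsJordanFrame e :=
  let ⟨D⟩ := nonempty_spectralDecomposition (0 : J)
  ⟨D.r, D.frame, D.isJordanFrame⟩

variable (J) in
theorem exists_traceLinear : ∃ τ : J →ₗ[ℝ] ℝ, ∀ x, trace x = τ x := by
  obtain ⟨B, hB⟩ := exists_isAssociativeInner J
  obtain ⟨r, e, he⟩ := exists_isJordanFrame J
  exact ⟨_, trace_eq_frameTrace hB he⟩

theorem IsPrimitiveIdempotent.trace_eq_one (hp : IsPrimitiveIdempotent p) : trace p = 1 := by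
  obtain ⟨B, hB⟩ := exists_isAssociativeInner J
  obtain ⟨r, e, he⟩ := exists_isJordanFrame J
  rw [trace_eq_frameTrace hB he, frameTrace_primitive hB he hp]

theorem IsJordanFrame.trace_mul_nonneg {r : ℕ} {e : Fin r → J} (he : IsJordanFrame e) (i : Fin r)
    (hq : q * q = q) : 0 ≤ trace (e i * q) := by
  obtain ⟨B, hB⟩ := exists_isAssociativeInner J
  -- Computing the trace along the frame `e` itself leaves only the term `k = i`.
  rw [trace_eq_frameTrace hB he, frameTrace_apply]
  refine Finset.sum_nonneg fun k _ => ?_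
  refine mul_nonneg (inv_nonneg.mpr (hB.nonneg _)) ?_
  rw [← hB.assoc]
  rcases eq_or_ne i k with rfl | h
  · rw [(he.primitive i).mul_self]
    exact hB.idem_nonneg (he.primitive i).mul_self hq
  · rw [he.orthogonal i k h, map_zero, LinearMap.zero_apply]

theorem IsJordanFrame.trace_sum_smul {r : ℕ} {e : Fin r → J} (he : IsJordanFrame e)
    (c : Fin r → ℝ) : trace (∑ i, c i • e i) = ∑ i, c i := by
  obtain ⟨τ, hτ⟩ := exists_traceLinear J
  rw [hτ, map_sum]
  refine Finset.sum_congr rfl fun i _ => ?_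
  rw [map_smul, ← hτ, (he.primitive i).trace_eq_one, smul_eq_mul, mul_one]

theorem eq_zero_of_trace_mul_self (h : trace (x * x) = 0) : x = 0 := by
  obtain ⟨D⟩ := nonempty_spectralDecomposition x
  rw [D.eq_sum, D.isJordanFrame.sum_smul_mul_sum_smul, D.isJordanFrame.trace_sum_smul,
    Finset.sum_eq_zero_iff_of_nonneg fun i _ => mul_self_nonneg _] at h
  rw [D.eq_sum]
  refine Finset.sum_eq_zero fun i hi => ?_
  rw [mul_self_eq_zero.mp (h i hi), zero_smul]

theorem IsJordanFrame.inner_sum_smul (hB : IsAssociativeInner B) {r : ℕ} {e : Fin r → J}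
    (he : IsJordanFrame e) (c : Fin r → ℝ) (j : Fin r) :
    B (∑ i, c i • e i) (e j) = c j * B (e j) (e j) := by
  rw [map_sum, LinearMap.sum_apply, Finset.sum_eq_single j]
  · simp
  · intro i _ hij
    rw [map_smul, LinearMap.smul_apply,
      hB.apply_eq_zero_of_mul (he.primitive j).mul_self (he.orthogonal i j hij), smul_zero]
  · simp

/-! ### The cone of squares and its interior. -/

theorem SpectralDecomposition.eigenvalue_nonneg (hB : IsAssociativeInner B)
    (D : SpectralDecomposition x) (j : Fin D.r) (h : 0 ≤ B x (D.frame j)) :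
    0 ≤ D.eigenvalue j := by
  have h1 := D.isJordanFrame.inner_sum_smul hB D.eigenvalue j
  rw [← D.eq_sum] at h1
  rw [h1] at h
  exact nonneg_of_mul_nonneg_left h (hB.pos _ (D.isJordanFrame.primitive j).ne_zero)

theorem SpectralDecomposition.mem_coneOfSquares (D : SpectralDecomposition x)
    (h : ∀ j, 0 ≤ D.eigenvalue j) : x ∈ coneOfSquares J := by
  refine ⟨∑ i, √(D.eigenvalue i) • D.frame i, ?_⟩
  rw [D.isJordanFrame.sum_smul_mul_sum_smul]
  simp only [Real.mul_self_sqrt (h _)]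
  exact D.eq_sum

theorem SpectralDecomposition.eigenvalue_nonneg_of_mem (D : SpectralDecomposition x)
    (hx : x ∈ coneOfSquares J) (j : Fin D.r) : 0 ≤ D.eigenvalue j := by
  obtain ⟨B, hB⟩ := exists_isAssociativeInner J
  refine D.eigenvalue_nonneg hB j ?_
  obtain ⟨y, hy⟩ := hx
  have h : B x (D.frame j) = B y (D.frame j * y) := by
    rw [mul_comm (D.frame j), ← hB.assoc, ← hy]
  rw [h]
  exact hB.idem_mul_nonneg (D.isJordanFrame.primitive j).mul_self y

theorem mem_coneOfSquares_of_inner_nonneg (hB : IsAssociativeInner B)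
    (h : ∀ q, IsPrimitiveIdempotent q → 0 ≤ B x q) : x ∈ coneOfSquares J :=
  let ⟨D⟩ := nonempty_spectralDecomposition x
  D.mem_coneOfSquares fun j => D.eigenvalue_nonneg hB j (h _ (D.isJordanFrame.primitive j))

theorem trace_add (x y : J) : trace (x + y) = trace x + trace y := by
  obtain ⟨τ, hτ⟩ := exists_traceLinear J
  simp only [hτ, map_add]

theorem trace_sub (x y : J) : trace (x - y) = trace x - trace y := by
  obtain ⟨τ, hτ⟩ := exists_traceLinear J
  simp only [hτ, map_sub]

theorem trace_smul (c : ℝ) (x : J) : trace (c • x) = c * trace x := by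
  obtain ⟨τ, hτ⟩ := exists_traceLinear J
  simp only [hτ, map_smul, smul_eq_mul]

variable (J) in
theorem trace_zero : trace (0 : J) = 0 := by
  simpa using trace_smul 0 (0 : J)

theorem trace_sum {ι : Type*} (s : Finset ι) (f : ι → J) :
    trace (∑ i ∈ s, f i) = ∑ i ∈ s, trace (f i) := by
  obtain ⟨τ, hτ⟩ := exists_traceLinear J
  simp only [hτ, map_sum]

theorem trace_sum_smul_mul_sum_smul {ι κ : Type*} [Fintype ι] [Fintype κ] (c : ι → ℝ)
    (p : ι → J) (d : κ → ℝ) (q : κ → J) :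
    trace ((∑ i, c i • p i) * ∑ j, d j • q j) =
      ∑ i, ∑ j, trace (p i * q j) * (c i * d j) := by
  simp only [Finset.sum_mul_sum, trace_sum, smul_mul_smul_comm, trace_smul]
  exact Finset.sum_congr rfl fun i _ => Finset.sum_congr rfl fun j _ => mul_comm _ _

theorem abs_eigenvalue_le (D : SpectralDecomposition x) {ε : ℝ} (hε : 0 < ε)
    (h : trace (x * x) < ε ^ 2) (j : Fin D.r) : |D.eigenvalue j| ≤ ε := by
  rw [D.eq_sum, D.isJordanFrame.sum_smul_mul_sum_smul, D.isJordanFrame.trace_sum_smul] at h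
  refine (abs_lt_of_sq_lt_sq (lt_of_le_of_lt ?_ h) hε.le).le
  rw [sq]
  exact Finset.single_le_sum (f := fun i => D.eigenvalue i * D.eigenvalue i)
    (fun i _ => mul_self_nonneg _) (Finset.mem_univ j)

theorem neg_mul_le_inner_of_trace_lt (hB : IsAssociativeInner B) {ε : ℝ} (hε : 0 < ε)
    (h : trace (x * x) < ε ^ 2) {q : J} (hq : IsPrimitiveIdempotent q) :
    -(ε * B 1 q) ≤ B x q := by
  obtain ⟨D⟩ := nonempty_spectralDecomposition x
  have hj := abs_eigenvalue_le D hε h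
  have h1 : B x q = ∑ j, D.eigenvalue j * B (D.frame j) q := by
    conv_lhs => rw [D.eq_sum]
    simp [LinearMap.sum_apply]
  rw [h1, ← D.isJordanFrame.sum_eq_one, map_sum, LinearMap.sum_apply, Finset.mul_sum,
    ← Finset.sum_neg_distrib]
  refine Finset.sum_le_sum fun j _ => ?_
  rw [← neg_mul]
  exact mul_le_mul_of_nonneg_right (abs_le.mp (hj j)).1
    (hB.idem_nonneg (D.isJordanFrame.primitive j).mul_self hq.mul_self)

theorem continuous_trace_mul_self [TopologicalSpace J] [IsTopologicalAddGroup J]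
    [ContinuousSMul ℝ J] [T2Space J] : Continuous fun x : J => trace (x * x) := by
  have b := Module.finBasis ℝ J
  have h : ∀ x : J, trace (x * x) = ∑ i, ∑ j, trace (b i * b j) * (b.repr x i * b.repr x j) := by
    intro x
    rw [← trace_sum_smul_mul_sum_smul, b.sum_repr]
  have hc : ∀ i, Continuous fun x => b.repr x i := fun i =>
    LinearMap.continuous_of_finiteDimensional (b.coord i)
  simp only [h]
  fun_prop

theorem IsJordanFrame.sum_smul_mem_interior [TopologicalSpace J] [IsTopologicalAddGroup J]
    [ContinuousSMul ℝ J] [T2Space J] {r : ℕ} {e : Fin r → J} (he : IsJordanFrame e)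
    {c : Fin r → ℝ} (hc : ∀ i, 0 < c i) : ∑ i, c i • e i ∈ interior (coneOfSquares J) := by
  obtain ⟨B, hB⟩ := exists_isAssociativeInner J
  obtain ⟨ε, hε, hεc⟩ : ∃ ε : ℝ, 0 < ε ∧ ∀ i, ε ≤ c i := by
    rcases isEmpty_or_nonempty (Fin r) with h | h
    · exact ⟨1, one_pos, fun i => isEmptyElim i⟩
    · obtain ⟨i, hi⟩ := Finite.exists_min c
      exact ⟨c i, hc i, hi⟩
  set y := ∑ i, c i • e i with hy
  -- In the open trace-norm ball of radius `ε`, the deviation from `y` costs at most `ε * B 1 q`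
  -- against a primitive `q`, while `B y q ≥ ε * B 1 q`.
  refine mem_interior.mpr ⟨{x | trace ((x - y) * (x - y)) < ε ^ 2}, fun x hx => ?_, ?_, ?_⟩
  · refine mem_coneOfSquares_of_inner_nonneg hB fun q hq => ?_
    have h1 := neg_mul_le_inner_of_trace_lt hB hε hx hq
    have h2 : ε * B 1 q ≤ B y q := by
      rw [← he.sum_eq_one, hy]
      simp only [map_sum, LinearMap.sum_apply, map_smul, LinearMap.smul_apply, Finset.mul_sum,
        smul_eq_mul]
      exact Finset.sum_le_sum fun i _ => mul_le_mul_of_nonneg_right (hεc i)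
        (hB.idem_nonneg (he.primitive i).mul_self hq.mul_self)
    rw [map_sub, LinearMap.sub_apply] at h1
    linarith
  · exact isOpen_lt (continuous_trace_mul_self.comp (continuous_id.sub continuous_const))
      continuous_const
  · simpa [trace_zero] using pow_pos hε 2

/-! ### The exponential and its normalization. -/

/-- One decomposition serves all `f` at once, so independence of the choice is never needed. -/
theorem exists_loewner_eq (x : J) : ∃ D : SpectralDecomposition x,
    ∀ f : ℝ → ℝ, loewner f x = ∑ i, f (D.eigenvalue i) • D.frame i :=
  ⟨(nonempty_spectralDecomposition x).some, fun _ => dif_pos (nonempty_spectralDecomposition x)⟩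

theorem exp_zero : exp (0 : J) = 1 := by
  obtain ⟨B, hB⟩ := exists_isAssociativeInner J
  obtain ⟨D, hD⟩ := exists_loewner_eq (0 : J)
  rw [exp, hD, ← D.isJordanFrame.sum_eq_one]
  refine Finset.sum_congr rfl fun i _ => ?_
  have h := D.isJordanFrame.inner_sum_smul hB D.eigenvalue i
  rw [← D.eq_sum, map_zero, LinearMap.zero_apply] at h
  rw [(mul_eq_zero.mp h.symm).resolve_right
    (hB.pos _ (D.isJordanFrame.primitive i).ne_zero).ne', Real.exp_zero, one_smul]

theorem exists_normalizedExp_eq [Nontrivial J] (w : J) :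
    ∃ (D : SpectralDecomposition w) (z : ℝ),
      ∑ i, Real.exp (D.eigenvalue i - z) = 1 ∧
      normalizedExp w = ∑ i, Real.exp (D.eigenvalue i - z) • D.frame i := by
  obtain ⟨D, hD⟩ := exists_loewner_eq w
  have htr : trace (exp w) = ∑ i, Real.exp (D.eigenvalue i) := by
    rw [exp, hD, D.isJordanFrame.trace_sum_smul]
  have hne : (Finset.univ : Finset (Fin D.r)).Nonempty := by
    by_contra h
    have h1 := D.isJordanFrame.sum_eq_one
    rw [Finset.not_nonempty_iff_eq_empty.mp h, Finset.sum_empty] at h1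
    exact zero_ne_one h1
  have hpos : 0 < trace (exp w) := by
    rw [htr]
    exact Finset.sum_pos (fun i _ => Real.exp_pos _) hne
  have he : ∀ i, Real.exp (D.eigenvalue i - Real.log (trace (exp w))) =
      (trace (exp w))⁻¹ * Real.exp (D.eigenvalue i) := by
    intro i
    rw [Real.exp_sub, Real.exp_log hpos, div_eq_inv_mul]
  refine ⟨D, Real.log (trace (exp w)), ?_, ?_⟩
  · simp only [he, ← Finset.mul_sum, ← htr]
    exact inv_mul_cancel₀ hpos.ne'
  · simp only [he, mul_smul, ← Finset.smul_sum]
    rw [normalizedExp, ← hD]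
    rfl

/-! ### The Gibbs variational principle. -/

/-- Fenchel–Young inequality for `exp` and `μ log μ - μ`, from `t + 1 ≤ exp t` at `t = a - log μ`.
-/
theorem entropy_gap_nonpos {a μ : ℝ} (hμ : 0 ≤ μ) :
    μ * a - μ * Real.log μ - Real.exp a + μ ≤ 0 := by
  rcases hμ.eq_or_lt with rfl | h
  · simp [Real.exp_nonneg]
  · have h1 := Real.add_one_le_exp (a - Real.log μ)
    rw [Real.exp_sub, Real.exp_log h, le_div_iff₀ h] at h1
    linarith

theorem eq_exp_of_entropy_gap {a μ : ℝ} (hμ : 0 ≤ μ)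
    (h0 : μ * a - μ * Real.log μ - Real.exp a + μ = 0) : μ = Real.exp a := by
  rcases hμ.eq_or_lt with rfl | h
  · simp at h0
  · by_contra hne
    have h1 := Real.add_one_lt_exp (x := a - Real.log μ) fun h2 => hne (by
      rw [sub_eq_zero.mp h2, Real.exp_log h])
    rw [Real.exp_sub, Real.exp_log h, lt_div_iff₀ h] at h1
    linarith

theorem entropy_gap_eq_zero (a : ℝ) :
    Real.exp a * a - Real.exp a * Real.log (Real.exp a) - Real.exp a + Real.exp a = 0 := by
  rw [Real.log_exp]
  ring

/-- The Gibbs variational principle: the value of the entropic objective at `x` in terms of the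
nonnegative doubly stochastic weights `trace (p i * q j)` between two Jordan frames. -/
theorem exists_gibbs [Nontrivial J] (w : J) : ∃ z : ℝ, ∀ x ∈ simplex J,
    ∃ (r s : ℕ) (A : Fin r → Fin s → ℝ) (a : Fin r → ℝ) (μ : Fin s → ℝ),
      (∀ i j, 0 ≤ A i j) ∧ (∀ j, 0 ≤ μ j) ∧
      inner w x - negEntropy x = z + ∑ i, ∑ j, A i j *
        (μ j * a i - μ j * Real.log (μ j) - Real.exp (a i) + μ j) ∧
      trace ((x - normalizedExp w) * (x - normalizedExp w)) =
        ∑ i, ∑ j, A i j * (μ j - Real.exp (a i)) ^ 2 := by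
  obtain ⟨D, z, hz, hy⟩ := exists_normalizedExp_eq w
  refine ⟨z, fun x hx => ?_⟩
  obtain ⟨E, hE⟩ := exists_loewner_eq x
  have hp := D.isJordanFrame
  have hq := E.isJordanFrame
  let A : Fin D.r → Fin E.r → ℝ := fun i j => trace (D.frame i * E.frame j)
  let a : Fin D.r → ℝ := fun i => D.eigenvalue i - z
  have hμ1 : ∑ j, E.eigenvalue j = 1 := by rw [← hq.trace_sum_smul, ← E.eq_sum, hx.2]
  have hcol : ∀ d : Fin E.r → ℝ, ∑ i, ∑ j, A i j * d j = ∑ j, d j := by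
    intro d
    rw [Finset.sum_comm]
    refine Finset.sum_congr rfl fun j _ => ?_
    rw [← Finset.sum_mul, ← trace_sum, ← Finset.sum_mul, hp.sum_eq_one, one_mul,
      (hq.primitive j).trace_eq_one, one_mul]
  have hrow : ∀ c : Fin D.r → ℝ, ∑ i, ∑ j, A i j * c i = ∑ i, c i := by
    intro c
    refine Finset.sum_congr rfl fun i _ => ?_
    rw [← Finset.sum_mul, ← trace_sum, ← Finset.mul_sum, hq.sum_eq_one, mul_one,
      (hp.primitive i).trace_eq_one, one_mul]
  refine ⟨D.r, E.r, A, a, E.eigenvalue,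
    fun i j => hp.trace_mul_nonneg i (hq.primitive j).mul_self,
    E.eigenvalue_nonneg_of_mem hx.1, ?_, ?_⟩
  · have h1 : inner w x = ∑ i, ∑ j, A i j * (D.eigenvalue i * E.eigenvalue j) := by
      rw [inner, ← trace_sum_smul_mul_sum_smul, ← D.eq_sum, ← E.eq_sum]
    have h2 : negEntropy x = ∑ j, E.eigenvalue j * Real.log (E.eigenvalue j) := by
      rw [negEntropy, log, hE, ← hq.trace_sum_smul, ← hq.sum_smul_mul_sum_smul, ← E.eq_sum]
    have h3 : z = ∑ i, ∑ j, A i j * (z * E.eigenvalue j) := by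
      rw [hcol fun j => z * E.eigenvalue j, ← Finset.mul_sum, hμ1, mul_one]
    have h4 : ∑ i, ∑ j, A i j * Real.exp (a i) = 1 := by rw [hrow fun i => Real.exp (a i), hz]
    have h5 := hcol E.eigenvalue
    rw [hμ1] at h5
    rw [← hcol fun j => E.eigenvalue j * Real.log (E.eigenvalue j)] at h2
    -- The added terms `- exp (a i)` and `μ j` cancel in total, since both `normalizedExp w` and `x`
    -- have trace one.
    have h6 : ∑ i, ∑ j, A i j * (E.eigenvalue j * a i -
          E.eigenvalue j * Real.log (E.eigenvalue j) - Real.exp (a i) + E.eigenvalue j) =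
        inner w x - ∑ i, ∑ j, A i j * (z * E.eigenvalue j) - negEntropy x -
          ∑ i, ∑ j, A i j * Real.exp (a i) + ∑ i, ∑ j, A i j * E.eigenvalue j := by
      rw [h1, h2]
      simp only [← Finset.sum_sub_distrib, ← Finset.sum_add_distrib]
      refine Finset.sum_congr rfl fun i _ => Finset.sum_congr rfl fun j _ => ?_
      simp only [a]
      ring
    rw [h6, ← h3, h4, h5]
    ring
  · set y := normalizedExp w with hy'
    have h1 : trace (x * x) = ∑ i, ∑ j, A i j * E.eigenvalue j ^ 2 := by
      rw [hcol fun j => E.eigenvalue j ^ 2]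
      simp only [sq]
      rw [← hq.trace_sum_smul, ← hq.sum_smul_mul_sum_smul, ← E.eq_sum]
    have h2 : trace (y * y) = ∑ i, ∑ j, A i j * Real.exp (a i) ^ 2 := by
      rw [hrow fun i => Real.exp (a i) ^ 2, hy, hp.sum_smul_mul_sum_smul, hp.trace_sum_smul]
      simp only [sq, a]
    have h3 : trace (y * x) = ∑ i, ∑ j, A i j * (Real.exp (a i) * E.eigenvalue j) := by
      rw [hy, ← trace_sum_smul_mul_sum_smul, ← E.eq_sum]
    have h4 : (x - y) * (x - y) = x * x - y * x - y * x + y * y := by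
      rw [sub_mul, mul_sub, mul_sub, mul_comm x y]
      abel
    rw [h4, trace_add, trace_sub, trace_sub, h1, h2, h3]
    simp only [← Finset.sum_sub_distrib, ← Finset.sum_add_distrib]
    refine Finset.sum_congr rfl fun i _ => Finset.sum_congr rfl fun j _ => ?_
    ring

theorem normalizedExp_mem_interior [TopologicalSpace J] [IsTopologicalAddGroup J]
    [ContinuousSMul ℝ J] [T2Space J] [Nontrivial J] (w : J) :
    normalizedExp w ∈ interior (coneOfSquares J) := by
  obtain ⟨D, z, -, hy⟩ := exists_normalizedExp_eq w
  rw [hy]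
  exact D.isJordanFrame.sum_smul_mem_interior fun i => Real.exp_pos _

theorem normalizedExp_mem_simplex [Nontrivial J] (w : J) : normalizedExp w ∈ simplex J := by
  obtain ⟨D, z, hz, hy⟩ := exists_normalizedExp_eq w
  refine ⟨?_, by rw [hy, D.isJordanFrame.trace_sum_smul, hz]⟩
  exact SpectralDecomposition.mem_coneOfSquares ⟨_, _, _, D.isJordanFrame, hy⟩
    fun j => Real.exp_nonneg _

theorem argmax_inner_sub_negEntropy [Nontrivial J] (w : J) :
    argmax (simplex J) (fun x => inner w x - negEntropy x) = {normalizedExp w} := by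
  obtain ⟨z, hz⟩ := exists_gibbs w
  have hle : ∀ x ∈ simplex J, inner w x - negEntropy x ≤ z := by
    intro x hx
    obtain ⟨r, s, A, a, μ, hA, hμ, h1, -⟩ := hz x hx
    rw [h1]
    have : ∑ i, ∑ j, A i j * (μ j * a i - μ j * Real.log (μ j) - Real.exp (a i) + μ j) ≤ 0 :=
      Finset.sum_nonpos fun i _ => Finset.sum_nonpos fun j _ =>
        mul_nonpos_of_nonneg_of_nonpos (hA i j) (entropy_gap_nonpos (hμ j))
    linarith
  have heq : ∀ x ∈ simplex J, inner w x - negEntropy x = z ↔ x = normalizedExp w := by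
    intro x hx
    obtain ⟨r, s, A, a, μ, hA, hμ, h1, h2⟩ := hz x hx
    rw [h1, add_eq_left]
    constructor
    · intro h0
      rw [Finset.sum_eq_zero_iff_of_nonpos fun i _ => Finset.sum_nonpos fun j _ =>
        mul_nonpos_of_nonneg_of_nonpos (hA i j) (entropy_gap_nonpos (hμ j))] at h0
      refine sub_eq_zero.mp (eq_zero_of_trace_mul_self (h2.trans ?_))
      refine Finset.sum_eq_zero fun i hi => Finset.sum_eq_zero fun j hj => ?_
      have h3 := (Finset.sum_eq_zero_iff_of_nonpos fun j _ =>
        mul_nonpos_of_nonneg_of_nonpos (hA i j) (entropy_gap_nonpos (hμ j))).mp (h0 i hi) j hj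
      rcases mul_eq_zero.mp h3 with h | h
      · rw [h, zero_mul]
      · rw [eq_exp_of_entropy_gap (hμ j) h, sub_self, zero_pow two_ne_zero, mul_zero]
    -- The squared-distance identity is read backwards: at `x = normalizedExp w` each weight
    -- vanishes or `μ j = exp (a i)`, so every gap term is zero, whichever decomposition of `x` was
    -- chosen.
    · intro h0
      have hnn : ∀ i j, 0 ≤ A i j * (μ j - Real.exp (a i)) ^ 2 := fun i j =>
        mul_nonneg (hA i j) (sq_nonneg _)
      have ht : trace ((x - normalizedExp w) * (x - normalizedExp w)) = 0 := by
        rw [h0, sub_self, mul_zero, trace_zero]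
      rw [ht, eq_comm, Finset.sum_eq_zero_iff_of_nonneg fun i _ =>
        Finset.sum_nonneg fun j _ => hnn i j] at h2
      refine Finset.sum_eq_zero fun i hi => Finset.sum_eq_zero fun j hj => ?_
      rcases mul_eq_zero.mp ((Finset.sum_eq_zero_iff_of_nonneg fun j _ => hnn i j).mp
        (h2 i hi) j hj) with h | h
      · rw [h, zero_mul]
      · rw [sub_eq_zero.mp (pow_eq_zero_iff two_ne_zero |>.mp h), entropy_gap_eq_zero, mul_zero]
  have hw := normalizedExp_mem_simplex w
  have hval := (heq _ hw).mpr rfl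
  ext x
  constructor
  · rintro ⟨hx, hmax⟩
    exact (heq x hx).mp (le_antisymm (hle x hx) (hval ▸ hmax hw))
  · rintro rfl
    exact ⟨hw, fun x hx => (hle x hx).trans hval.ge⟩

theorem argmax_oftrlObjective [Nontrivial J] (η : ℝ) (m m' : ℕ → J) (t : ℕ) :
    argmax (simplex J) (oftrlObjective negEntropy η m m' t) = {oscmwuIterate η m m' t} := by
  have h : oftrlObjective negEntropy η m m' t =
      fun x => inner (oscmwuWeight η m m' t) x - negEntropy x := by
    funext x
    rw [oftrlObjective, oscmwuWeight, inner, inner, smul_mul_assoc, trace_smul]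
  rw [h, argmax_inner_sub_negEntropy]
  rfl

theorem argmin_negEntropy [Nontrivial J] :
    argmin (simplex J) negEntropy = {(trace (1 : J))⁻¹ • (1 : J)} := by
  -- Minimizing the entropy is the case `w = 0`, where `exp 0 = 1` gives the barycenter.
  have h := argmax_inner_sub_negEntropy (0 : J)
  rw [normalizedExp, exp_zero] at h
  rw [← h]
  have h0 : ∀ x : J, inner 0 x = 0 := fun x => by
    rw [inner, zero_mul, trace_zero]
  ext x
  simp [argmin, argmax, isMinOn_iff, isMaxOn_iff, h0]

end Algebra
end EJA

theorem mainTheorem5 {J : Type*} [NonAssocCommRing J] [Module ℝ J] [IsEuclideanJordanAlgebra J]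
    [TopologicalSpace J] [IsTopologicalAddGroup J] [ContinuousSMul ℝ J] [T2Space J]
    [Nontrivial J] :
    -- `exp w / tr (exp w)` is an interior point of the cone, and it is the unique maximizer
    (∀ w : J,
      EJA.normalizedExp w ∈ interior (EJA.coneOfSquares J) ∧
      EJA.argmax (EJA.simplex J) (fun x => EJA.inner w x - EJA.negEntropy x) =
        {EJA.normalizedExp w}) ∧
    -- for all data, every OFTRL step has the OSCMWU iterate as its unique solution
    (∀ (η : ℝ), 0 < η → ∀ (m m' : ℕ → J) (t : ℕ),
      EJA.argmax (EJA.simplex J) (EJA.oftrlObjective EJA.negEntropy η m m' t) =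
        {EJA.oscmwuIterate η m m' t}) ∧
    -- the OFTRL sequences are the OSCMWU sequences started at the barycenter `e / tr e`
    (∀ (η : ℝ), 0 < η → ∀ (m m' x : ℕ → J),
      EJA.IsOFTRL EJA.negEntropy η m m' x ↔
        x 0 = (EJA.trace (1 : J))⁻¹ • (1 : J) ∧
        ∀ t, x (t + 1) = EJA.oscmwuIterate η m m' t) := by
  refine ⟨fun w => ⟨EJA.normalizedExp_mem_interior w, EJA.argmax_inner_sub_negEntropy w⟩,
    fun η _ m m' t => EJA.argmax_oftrlObjective η m m' t, fun η _ m m' x => ⟨fun h => ?_, ?_⟩⟩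
  · have h0 := h.init
    rw [EJA.argmin_negEntropy] at h0
    refine ⟨h0, fun t => ?_⟩
    have ht := h.step t
    rw [EJA.argmax_oftrlObjective] at ht
    exact ht
  · rintro ⟨h0, ht⟩
    refine ⟨?_, fun t => ?_⟩
    · rw [EJA.argmin_negEntropy]
      exact h0
    · rw [EJA.argmax_oftrlObjective]
      exact ht t
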